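/- Let $n \ge 1$ be an integer and let $0 < \epsilon < \delta(n) = \frac{2^{n+2}\pi}{3(2^{n+2}-1)}$. Then there is a wavelet $\psi$, that is, a function $\psi \in L^2(\mathbb{R})$ (complex-valued) for which $\{2^{j/2}\psi(2^j \cdot - k) : j, k \in \mathbb{Z}\}$ is an orthonormal basis of $L^2(\mathbb{R})$, such that $$\operatorname{supp} \hat\psi \subseteq \left[-\frac{2^{n+2}}{3}\pi,\ \frac{2^{n+2}}{3}\pi + \epsilon\right] \quad\text{and}\quad \|D_\psi\|_\infty > n .$$ Here $\hat\psi$ is the Fourier transform of $\psi$ in the normalization $\hat\psi(\xi) = \int_{\mathbb{R}} \psi(x) e^{-i\xi x}\,dx$ (extended to $L^2(\mathbb{R})$), $\operatorname{supp}\hat\psi$ is the closed essential support (the set of points no neighbourhood of which is one on which $\hat\psi$ vanishes almost everywhere), $D_\psi(\xi) = \sum_{j \ge 1} \sum_{k \in \mathbb{Z}} |\hat\psi(2^j(\xi + 2k\pi))|^2$ is the dimension function of $\psi$, and $\|\cdot\|_\infty$ is the essential supremum norm on $\mathbb{R}$. -/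

import Mathlib

open MeasureTheory
open scoped ENNReal FourierTransform Topology

noncomputable section

/-- The function `ψ_{j,k}(x) = 2^{j/2} ψ(2^j x - k)` built from a square-integrable `ψ`. -/
def waveletSystem (ψ : Lp ℂ 2 (volume : Measure ℝ)) (j k : ℤ) (x : ℝ) : ℂ :=
  (((2 : ℝ) ^ ((j : ℝ) / 2) : ℝ) : ℂ) * ψ ((2 : ℝ) ^ j * x - (k : ℝ))

/-- `ψ ∈ L²(ℝ)` is a wavelet: `{ψ_{j,k} : j, k ∈ ℤ}` is an orthonormal basis of `L²(ℝ)`. -/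
def IsWavelet (ψ : Lp ℂ 2 (volume : Measure ℝ)) : Prop :=
  ∃ b : HilbertBasis (ℤ × ℤ) ℂ (Lp ℂ 2 (volume : Measure ℝ)),
    ∀ j k : ℤ, b (j, k) =ᵐ[volume] waveletSystem ψ j k

/-- The Fourier transform on `L²(ℝ)` in the normalization `ψ̂(ξ) = ∫ ψ(x) e^{-iξx} dx`
(the one for which `‖ψ̂‖₂² = 2π ‖ψ‖₂²`), as a function defined up to null sets.
Mathlib's transform `𝓕` on `L²(ℝ)` has the kernel `e^{-2πiξx}`, hence the rescaling. -/
def angularFourier (ψ : Lp ℂ 2 (volume : Measure ℝ)) (ξ : ℝ) : ℂ :=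
  (𝓕 ψ : Lp ℂ 2 (volume : Measure ℝ)) (ξ / (2 * Real.pi))

/-- The (closed, essential) support of a function defined up to null sets: the points none of
whose neighbourhoods is one on which the function vanishes almost everywhere. -/
def essentialSupport (f : ℝ → ℂ) : Set ℝ :=
  {x | ∀ U ∈ 𝓝 x, 0 < volume {y | y ∈ U ∧ f y ≠ 0}}

/-- The dimension function `D_ψ(ξ) = ∑_{j ≥ 1} ∑_{k ∈ ℤ} |ψ̂(2^j (ξ + 2kπ))|²`,
a sum of non-negative terms; the index `i : ℕ` stands for `j = i + 1`. -/
def dimensionFunction (ψ : Lp ℂ 2 (volume : Measure ℝ)) (ξ : ℝ) : ℝ≥0∞ :=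
  ∑' (i : ℕ) (k : ℤ),
    ‖angularFourier ψ ((2 : ℝ) ^ (i + 1) * (ξ + 2 * (k : ℝ) * Real.pi))‖ₑ ^ 2

end

/-! Frequencies are measured in units of 2π. If a measurable set W tiles the line both by integer
translations and by dyadic dilations, its indicator is the transform of a wavelet
(`exists_isWavelet_of_tile`): translation tiling makes the exponentials an orthonormal basis of
L²(W), and dilation tiling spreads these bases over L²(ℝ).

Such a W is built from the Shannon set S = [-1, -1/2) ∪ [1/2, 1). Let I(c) = ±2/3 + [0, c) be
`innerPart c`. Since (-2)^n ≡ 1 mod 3, integer translations carry I(c) onto the far set O =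
±2^(n+1)/3 + [0, c). Dilation by 2^n, however, reaches O from the smaller I(c/2^n) only, so the
dilation orbits of I(c) \ I(c/2^n) are lost. They are recovered by adding x/4 for each lost x. Now
x/4 is an integer translate of the point Qx = x/4 ∓ 1 of S, so Qx must leave, its dilation orbit is
lost in turn, and the repair is iterated. With M the set of all lost points, W = (S \ (I(c) ∪ QM)) ∪
O ∪ M/4 tiles in both ways.

For x just above 1/3 and each 0 ≤ i ≤ n, some integer k puts 2^(i+1)(x + k) in O, again because
powers of -2 are 1 mod 3. So the dimension function is at least n + 1 on an interval
(`succ_le_tsum_indicator_farWaveletSet`). -/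

/-! ### The inverse Fourier transform on L¹ ∩ L² -/

/-- On `L¹ ∩ L²` the inverse Fourier transform of `L²` is given by the Fourier integral. -/
theorem Lp.fourierInv_ae_eq_of_integrable (f : Lp ℂ 2 (volume : Measure ℝ))
    (hf : Integrable f volume) :
    ((𝓕⁻ f : Lp ℂ 2 (volume : Measure ℝ)) : ℝ → ℂ) =ᵐ[volume] 𝓕⁻ (f : ℝ → ℂ) := by
  have hcont : Continuous (𝓕⁻ (f : ℝ → ℂ)) := by
    rw [Real.fourierInv_eq_fourier_comp_neg]
    exact VectorFourier.fourierIntegral_continuous Real.continuous_fourierChar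
      (by fun_prop) hf.comp_neg
  -- Both sides are tested against smooth compactly supported `g`. Duality of tempered distributions
  -- moves the L² transform onto `g`, and Fubini (`h4`) moves it back onto `f` as an integral.
  refine ae_eq_of_integral_contDiff_smul_eq
    ((Lp.memLp _).locallyIntegrable (by norm_num)) hcont.locallyIntegrable fun g hg hgc => ?_
  have hg₁ : HasCompactSupport (Complex.ofRealCLM ∘ g) := hgc.comp_left rfl
  have hg₂ : ContDiff ℝ ((⊤ : ℕ∞) : WithTop ℕ∞) (Complex.ofRealCLM ∘ g) := by fun_prop
  set u : SchwartzMap ℝ ℂ := hg₁.toSchwartzMap hg₂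
  have h1 := congrArg (fun T => T u) (Lp.fourierInv_toTemperedDistribution_eq f)
  simp only [TemperedDistribution.fourierInv_apply, Lp.toTemperedDistribution_apply] at h1
  have h2 : ∀ x, u x = (g x : ℂ) := fun x => rfl
  have h3 : ∫ x, g x • (𝓕⁻ f : Lp ℂ 2 (volume : Measure ℝ)) x
      = ∫ x, (𝓕⁻ u) x • f x := by
    rw [h1]; simp [h2]
  have h4 := VectorFourier.integral_fourierIntegral_smul_eq_flip (μ := volume) (ν := volume)
     (f := (u : ℝ → ℂ)) (g := (f : ℝ → ℂ)) (L := -innerₗ ℝ) Real.continuous_fourierChar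
     (by simpa using! continuous_inner.neg) u.integrable hf
  have h5 : ∀ x, (𝓕⁻ u) x = VectorFourier.fourierIntegral Real.fourierChar volume (-innerₗ ℝ)
      (u : ℝ → ℂ) x := fun x => by
    rw [SchwartzMap.fourierInv_coe]; rfl
  have h6 : ∀ x, 𝓕⁻ (f : ℝ → ℂ) x = VectorFourier.fourierIntegral Real.fourierChar volume
      (-innerₗ ℝ).flip (f : ℝ → ℂ) x := fun x => by
    simp [Real.fourierInv_eq, VectorFourier.fourierIntegral, mul_comm]
  rw [h3]
  simp only [h5, h6, Complex.real_smul]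
  exact h4

/-! ### Translation tiles and Fourier series on the circle -/

theorem isAddFundamentalDomain_of_existsUnique {W : Set ℝ} (hW : MeasurableSet W)
    (h : ∀ x : ℝ, ∃! k : ℤ, x + k ∈ W) :
    IsAddFundamentalDomain (AddSubgroup.zmultiples (1 : ℝ)) W volume := by
  refine IsAddFundamentalDomain.mk' hW.nullMeasurableSet fun x => ?_
  obtain ⟨k, hk, hu⟩ := h x
  refine ⟨⟨(k : ℝ), ⟨k, by simp⟩⟩, by simpa [AddSubgroup.vadd_def, add_comm] using hk, ?_⟩
  rintro ⟨_, ⟨l, rfl⟩⟩ hl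
  have := hu l (by simpa [AddSubgroup.vadd_def, add_comm] using hl)
  simp [this]

theorem measurePreserving_coe_unitAddCircle {W : Set ℝ} (hW : MeasurableSet W)
    (h : ∀ x : ℝ, ∃! k : ℤ, x + k ∈ W) :
    MeasurePreserving (fun x : ℝ => (x : UnitAddCircle)) (volume.restrict W) volume := by
  have h0 := UnitAddCircle.measurePreserving_mk 0
  refine ⟨h0.measurable, ?_⟩
  rw [← h0.map_eq]
  ext B hB
  rw [Measure.map_apply h0.measurable hB, Measure.map_apply h0.measurable hB,
    Measure.restrict_apply (h0.measurable hB), Measure.restrict_apply (h0.measurable hB)]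
  refine (isAddFundamentalDomain_of_existsUnique hW h).measure_set_eq
    (isAddFundamentalDomain_Ioc zero_lt_one 0) (h0.measurable hB) ?_
  rintro ⟨_, ⟨l, rfl⟩⟩
  ext x
  have hl : ((l : ℝ) : UnitAddCircle) = 0 := (AddCircle.coe_eq_zero_iff 1).2 ⟨l, by simp⟩
  simp [AddSubgroup.vadd_def, hl]

theorem coe_unitAddCircle_eq_iff (x y : ℝ) :
    (x : UnitAddCircle) = (y : UnitAddCircle) ↔ ∃ k : ℤ, x + k = y := by
  rw [eq_comm, ← sub_eq_zero, ← AddCircle.coe_sub, AddCircle.coe_eq_zero_iff]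
  simp only [zsmul_eq_mul, mul_one, eq_sub_iff_add_eq, add_comm]

theorem unitAddCircle_volume_eq_haar :
    (volume : Measure UnitAddCircle) = AddCircle.haarAddCircle := by
  rw [AddCircle.volume_eq_smul_haarAddCircle]; simp

/-- A square-integrable function on a translation tile all of whose Fourier coefficients vanish
is zero almost everywhere. -/
theorem ae_eq_zero_of_forall_fourier_integral_eq_zero {W : Set ℝ} (hW : MeasurableSet W)
    (h : ∀ x : ℝ, ∃! k : ℤ, x + k ∈ W) {f : ℝ → ℂ} (hf : MemLp f 2 (volume.restrict W))
    (h0 : ∀ k : ℤ, ∫ x in W, fourier k (x : UnitAddCircle) * f x = 0) :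
    f =ᵐ[volume.restrict W] 0 := by
  -- The projection `q` of the tile to the circle is injective and measure preserving, so `f`
  -- becomes an L² function `H` on the circle, where the Fourier basis is complete.
  set q : W → UnitAddCircle := fun w => ((w : ℝ) : UnitAddCircle) with hq
  have hval := measurePreserving_subtype_coe (μa := (volume : Measure ℝ)) hW
  have hvalE := MeasurableEmbedding.subtype_coe hW
  have hqmp : MeasurePreserving q (volume.comap Subtype.val) AddCircle.haarAddCircle := by
    rw [← unitAddCircle_volume_eq_haar]
    exact (measurePreserving_coe_unitAddCircle hW h).comp hval
  have hinj : Function.Injective q := by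
    intro x y hxy
    obtain ⟨k, hk⟩ := (coe_unitAddCircle_eq_iff _ _).1 hxy
    have h1 := (h x).unique (y₁ := k) (y₂ := 0) (by rw [hk]; exact y.2) (by simp)
    ext
    simpa [h1] using hk
  have : StandardBorelSpace W := hW.standardBorel
  have hqE : MeasurableEmbedding q := hqmp.measurable.measurableEmbedding hinj
  set H : UnitAddCircle → ℂ := Function.extend q (fun w => f w) 0 with hH
  have hHq : ∀ w, H (q w) = f w := fun w => hinj.extend_apply _ _ _
  have hHL : MemLp H 2 AddCircle.haarAddCircle := by
    rw [← hqmp.map_eq, hqE.memLp_map_measure_iff]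
    rw [← hval.map_eq, hvalE.memLp_map_measure_iff] at hf
    exact hf.congr_norm (hf.1.congr (.of_forall fun w => (hHq w).symm))
      (.of_forall fun w => by simp [hHq])
  have hHk : ∀ k : ℤ, ∫ t, fourier (-k) t • H t ∂AddCircle.haarAddCircle = 0 := fun k => by
    rw [← hqmp.map_eq, hqE.integral_map]
    have := h0 (-k)
    rw [← hval.map_eq, hvalE.integral_map] at this
    simp only [hHq, smul_eq_mul]
    exact this
  have hHz : hHL.toLp H = 0 := by
    apply (fourierBasis (T := 1)).repr.injective
    ext k
    rw [fourierBasis_repr, fourierCoeff_congr_ae hHL.coeFn_toLp, fourierCoeff, hHk, map_zero]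
    rfl
  have hHae : H =ᵐ[AddCircle.haarAddCircle] 0 :=
    hHL.coeFn_toLp.symm.trans (by rw [hHz]; exact Lp.coeFn_zero _ _ _)
  rw [← hqmp.map_eq] at hHae
  have h1 := hqE.ae_map_iff.1 hHae
  rw [← hval.map_eq]
  refine hvalE.ae_map_iff.2 ?_
  filter_upwards [h1] with w hw
  simpa [hHq] using hw

theorem setIntegral_fourier_of_tile {W : Set ℝ} (hW : MeasurableSet W)
    (h : ∀ x : ℝ, ∃! k : ℤ, x + k ∈ W) (k : ℤ) :
    ∫ x in W, (fourier k (x : UnitAddCircle) : ℂ) = if k = 0 then 1 else 0 := by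
  have hm := (measurePreserving_coe_unitAddCircle hW h)
  have h1 := integral_map (μ := volume.restrict W) hm.measurable.aemeasurable
    (f := fun t : UnitAddCircle => (fourier k t : ℂ)) (by fun_prop)
  rw [← h1, hm.map_eq, unitAddCircle_volume_eq_haar]
  have h2 := orthonormal_iff_ite.1 (orthonormal_fourier (T := 1)) 0 k
  rw [ContinuousMap.inner_toLp] at h2
  simpa [eq_comm] using h2

theorem volume_of_tile {W : Set ℝ} (hW : MeasurableSet W)
    (h : ∀ x : ℝ, ∃! k : ℤ, x + k ∈ W) : volume W = 1 := by
  rw [(isAddFundamentalDomain_of_existsUnique hW h).measure_eq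
    (isAddFundamentalDomain_Ioc zero_lt_one 0)]
  simp

/-! ### From a set tiling in both ways to a wavelet -/

theorem quasiMeasurePreserving_const_mul {a : ℝ} (ha : a ≠ 0) :
    Measure.QuasiMeasurePreserving (fun x : ℝ => a * x) volume volume := by
  refine ⟨by fun_prop, ?_⟩
  rw [Real.map_volume_mul_left ha]
  exact Measure.smul_absolutelyContinuous

theorem quasiMeasurePreserving_const_mul_sub {a : ℝ} (ha : a ≠ 0) (b : ℝ) :
    Measure.QuasiMeasurePreserving (fun x : ℝ => a * x - b) volume volume :=
  (measurePreserving_sub_right volume b).quasiMeasurePreserving.comp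
    (quasiMeasurePreserving_const_mul ha)

theorem memLp_comp_const_mul {f : ℝ → ℂ} {p : ℝ≥0∞} (hf : MemLp f p volume) {a : ℝ}
    (ha : a ≠ 0) : MemLp (fun x => f (a * x)) p volume := by
  have h : MemLp f p (Measure.map (fun x : ℝ => a * x) volume) := by
    rw [Real.map_volume_mul_left ha]
    exact hf.smul_measure (by finiteness)
  exact (memLp_map_measure_iff h.1 (by fun_prop)).1 h

/-- The function `2^{-j/2} e^{-2πi k 2^{-j} ξ} 1_W(2^{-j} ξ)`, the Fourier transform of
`ψ_{j,k}` when that of `ψ` is the indicator of `W`. -/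
noncomputable def tileAtom (W : Set ℝ) (j k : ℤ) (ξ : ℝ) : ℂ :=
  W.indicator (fun x => (((2 : ℝ) ^ (-(j : ℝ) / 2) : ℝ) : ℂ) * fourier (-k) (x : UnitAddCircle))
    ((2 : ℝ) ^ (-j) * ξ)

theorem memLp_tileAtom {W : Set ℝ} (hW : MeasurableSet W) (hv : volume W ≠ ∞) (j k : ℤ)
    (p : ℝ≥0∞) : MemLp (tileAtom W j k) p volume := by
  refine memLp_comp_const_mul (f := W.indicator _) ?_ (by positivity)
  rw [memLp_indicator_iff_restrict hW]
  have : IsFiniteMeasure (volume.restrict W) := ⟨by simpa using hv.lt_top⟩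
  refine MemLp.of_bound ?_ ((2 : ℝ) ^ (-(j : ℝ) / 2)) (.of_forall fun x => ?_)
  · refine Continuous.aestronglyMeasurable ?_
    have : Continuous fun x : ℝ => (x : UnitAddCircle) := AddCircle.continuous_mk' 1
    fun_prop
  · rw [norm_mul, Complex.norm_real, fourier_apply, Circle.norm_coe, mul_one,
      Real.norm_of_nonneg (by positivity)]

theorem conj_tileAtom_mul (W : Set ℝ) (j k : ℤ) (ξ : ℝ) (z : ℂ) :
    starRingEnd ℂ (tileAtom W j k ξ) * z =
      W.indicator (fun x => (((2 : ℝ) ^ (-(j : ℝ) / 2) : ℝ) : ℂ) *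
        (fourier k (x : UnitAddCircle))) ((2 : ℝ) ^ (-j) * ξ) * z := by
  unfold tileAtom
  by_cases h : (2 : ℝ) ^ (-j) * ξ ∈ W
  · rw [Set.indicator_of_mem h, Set.indicator_of_mem h, map_mul, Complex.conj_ofReal,
      ← fourier_neg, neg_neg]
  · rw [Set.indicator_of_notMem h, Set.indicator_of_notMem h, map_zero]

theorem integral_conj_tileAtom_mul {W : Set ℝ} (hW : MeasurableSet W) (j k : ℤ) (F : ℝ → ℂ) :
    ∫ ξ, starRingEnd ℂ (tileAtom W j k ξ) * F ξ =
      (((2 : ℝ) ^ ((j : ℝ) / 2) : ℝ) : ℂ) *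
        ∫ x in W, fourier k (x : UnitAddCircle) * F ((2 : ℝ) ^ j * x) := by
  have h1 : ∀ ξ, starRingEnd ℂ (tileAtom W j k ξ) * F ξ =
      (fun y => W.indicator (fun x => (((2 : ℝ) ^ (-(j : ℝ) / 2) : ℝ) : ℂ) *
        (fourier k (x : UnitAddCircle) * F ((2 : ℝ) ^ j * x))) y) ((2 : ℝ) ^ (-j) * ξ) := by
    intro ξ
    have h2 : (2 : ℝ) ^ j * ((2 : ℝ) ^ (-j) * ξ) = ξ := by
      rw [← mul_assoc, ← zpow_add₀ two_ne_zero]; simp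
    rw [conj_tileAtom_mul]
    by_cases h : (2 : ℝ) ^ (-j) * ξ ∈ W
    · simp only [Set.indicator_of_mem h, h2, mul_assoc]
    · simp only [Set.indicator_of_notMem h, zero_mul]
  simp_rw [h1]
  rw [Measure.integral_comp_mul_left, integral_indicator hW, integral_const_mul,
    Complex.real_smul, ← mul_assoc, ← Complex.ofReal_mul]
  congr 3
  rw [abs_of_pos (by positivity), ← zpow_neg, neg_neg, ← Real.rpow_intCast, ← Real.rpow_add two_pos]
  congr 1; ring

section

variable {W : Set ℝ}

/-- `tileAtom` as an element of `L²`. -/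
noncomputable def tileAtomLp (hW : MeasurableSet W) (hv : volume W ≠ ∞) (p : ℤ × ℤ) :
    Lp ℂ 2 (volume : Measure ℝ) :=
  (memLp_tileAtom hW hv p.1 p.2 2).toLp

theorem inner_tileAtomLp (hW : MeasurableSet W) (hv : volume W ≠ ∞) (p : ℤ × ℤ)
    (f : Lp ℂ 2 (volume : Measure ℝ)) :
    inner ℂ (tileAtomLp hW hv p) f = (((2 : ℝ) ^ ((p.1 : ℝ) / 2) : ℝ) : ℂ) *
        ∫ x in W, fourier p.2 (x : UnitAddCircle) * f ((2 : ℝ) ^ p.1 * x) := by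
  rw [← integral_conj_tileAtom_mul hW, L2.inner_def]
  refine integral_congr_ae ?_
  filter_upwards [(memLp_tileAtom hW hv p.1 p.2 2).coeFn_toLp] with x hx
  rw [RCLike.inner_apply', tileAtomLp, hx]

theorem orthonormal_tileAtomLp (hW : MeasurableSet W) (hv : volume W ≠ ∞)
    (ht : ∀ x : ℝ, ∃! k : ℤ, x + k ∈ W)
    (hd : ∀ x : ℝ, x ≠ 0 → ∃! j : ℤ, (2 : ℝ) ^ j * x ∈ W) :
    Orthonormal ℂ (tileAtomLp hW hv) := by
  rw [orthonormal_iff_ite]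
  rintro ⟨j, k⟩ ⟨j', k'⟩
  rw [inner_tileAtomLp]
  have h0 : (2 : ℝ) ^ j ≠ 0 := by positivity
  have h1 := (quasiMeasurePreserving_const_mul h0).ae
    (memLp_tileAtom hW hv j' k' 2).coeFn_toLp
  have hne : ∀ᵐ x : ℝ, x ≠ 0 := by simp [ae_iff]
  have hmul : ∀ x : ℝ, (2 : ℝ) ^ (-j) * ((2 : ℝ) ^ j * x) = x := fun x => by
    rw [← mul_assoc, ← zpow_add₀ two_ne_zero]; simp
  by_cases hj : j = j'
  · subst hj
    have h2 : ∫ x in W, fourier k (x : UnitAddCircle) *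
        tileAtomLp hW hv (j, k') ((2 : ℝ) ^ j * x) =
        ∫ x in W, (((2 : ℝ) ^ (-(j : ℝ) / 2) : ℝ) : ℂ) *
          (fourier (k - k') (x : UnitAddCircle) : ℂ) := by
      refine setIntegral_congr_ae hW ?_
      filter_upwards [h1] with x hx hxW
      rw [tileAtomLp, hx, tileAtom, hmul, Set.indicator_of_mem hxW, sub_eq_add_neg, fourier_add]
      ring
    rw [h2, integral_const_mul, setIntegral_fourier_of_tile hW ht, ← mul_assoc,
      ← Complex.ofReal_mul, ← Real.rpow_add two_pos]
    simp [sub_eq_zero, neg_div]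
  -- At different scales the two atoms live on different dilates of W, which are disjoint away from
  -- 0.
  · have h2 : ∫ x in W, fourier k (x : UnitAddCircle) *
        tileAtomLp hW hv (j', k') ((2 : ℝ) ^ j * x) = 0 := by
      refine setIntegral_eq_zero_of_ae_eq_zero ?_
      filter_upwards [h1, hne] with x hx hx0 hxW
      rw [tileAtomLp, hx, tileAtom, Set.indicator_of_notMem, mul_zero]
      intro hc
      have := (hd _ (mul_ne_zero h0 hx0)).unique hc (by rwa [hmul])
      omega
    rw [h2, mul_zero, if_neg (by simp [hj])]

theorem eq_zero_of_inner_tileAtomLp_eq_zero (hW : MeasurableSet W) (hv : volume W ≠ ∞)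
    (ht : ∀ x : ℝ, ∃! k : ℤ, x + k ∈ W)
    (hd : ∀ x : ℝ, x ≠ 0 → ∃! j : ℤ, (2 : ℝ) ^ j * x ∈ W)
    (f : Lp ℂ 2 (volume : Measure ℝ)) (hf : ∀ p, inner ℂ (tileAtomLp hW hv p) f = 0) :
    f = 0 := by
  have h1 : ∀ j : ℤ, ∀ᵐ ξ : ℝ, (2 : ℝ) ^ j * ξ ∈ W → f ξ = 0 := by
    intro j
    -- The atoms of scale `-j` compute the Fourier coefficients on W of x ↦ f(2^(-j) x), so f
    -- vanishes a.e. on the dilate 2^(-j) W. These dilates cover every nonzero point.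
    have h2 := ae_eq_zero_of_forall_fourier_integral_eq_zero hW ht
      ((memLp_comp_const_mul (Lp.memLp f) (a := (2 : ℝ) ^ (-j)) (by positivity)).restrict W)
      (fun k => by
        have := hf (-j, k)
        rw [inner_tileAtomLp] at this
        refine (mul_eq_zero.1 this).resolve_left ?_
        exact_mod_cast (by positivity : (2 : ℝ) ^ (((-j : ℤ) : ℝ) / 2) ≠ 0))
    rw [Filter.EventuallyEq, ae_restrict_iff' hW] at h2
    filter_upwards [(quasiMeasurePreserving_const_mul
      (by positivity : (2 : ℝ) ^ j ≠ 0)).ae h2] with ξ hξ hm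
    have h3 := hξ hm
    rwa [← mul_assoc, ← zpow_add₀ two_ne_zero, neg_add_cancel, zpow_zero, one_mul] at h3
  have hne : ∀ᵐ x : ℝ, x ≠ 0 := by simp [ae_iff]
  rw [Lp.eq_zero_iff_ae_eq_zero]
  filter_upwards [ae_all_iff.2 h1, hne] with ξ hξ h0
  obtain ⟨j, hj, -⟩ := hd ξ h0
  exact hξ j hj

/-- Substituting ξ = 2^j η turns the modulation of the atom into a translation by k; the Jacobian
2^j times the factor 2^(-j/2) leaves 2^(j/2). -/
theorem fourierInv_tileAtom (W : Set ℝ) (j k : ℤ) (x : ℝ) :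
    𝓕⁻ (tileAtom W j k) x = (((2 : ℝ) ^ ((j : ℝ) / 2) : ℝ) : ℂ) *
      𝓕⁻ (tileAtom W 0 0) ((2 : ℝ) ^ j * x - k) := by
  rw [Real.fourierInv_eq', Real.fourierInv_eq', ← integral_const_mul]
  have h := Measure.integral_comp_mul_left (fun ξ : ℝ =>
    (((2 : ℝ) ^ (-(j : ℝ) / 2) : ℝ) : ℂ) *
    (Complex.exp (((2 * Real.pi * inner ℝ ξ ((2 : ℝ) ^ j * x - k) : ℝ) : ℂ) * Complex.I) •
      tileAtom W 0 0 ξ)) ((2 : ℝ) ^ (-j))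
  rw [← integral_smul] at h
  convert h using 1
  · congr 1; ext ξ
    simp only [tileAtom]
    by_cases hm : (2 : ℝ) ^ (-j) * ξ ∈ W
    · have h2 : (2 : ℝ) ^ j * (2 : ℝ) ^ (-j) = 1 := by
        rw [← zpow_add₀ two_ne_zero]; simp
      have h3 : inner ℝ ((2 : ℝ) ^ (-j) * ξ) ((2 : ℝ) ^ j * x - k) =
          ξ * x - k * ((2 : ℝ) ^ (-j) * ξ) := by
        simp only [RCLike.inner_apply', conj_trivial]
        linear_combination (ξ * x) * h2
      simp only [neg_zero, zpow_zero, one_mul, Set.indicator_of_mem hm, h3]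
      simp only [fourier_coe_apply, smul_eq_mul]
      rw [mul_left_comm, ← Complex.exp_add]
      simp only [RCLike.inner_apply', conj_trivial]
      simp
      left; congr 1; ring
    · simp only [neg_zero, zpow_zero, one_mul, Set.indicator_of_notMem hm, smul_zero, mul_zero]
  · congr 1; ext ξ
    rw [Complex.real_smul, ← mul_assoc, ← Complex.ofReal_mul]
    congr 3
    rw [abs_of_pos (by positivity), ← zpow_neg, neg_neg, ← Real.rpow_intCast,
      ← Real.rpow_add two_pos]
    congr 1; ring

/-- A set tiling the line by integer translations and by dyadic dilations is a wavelet set. -/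
theorem exists_isWavelet_of_tile (hW : MeasurableSet W)
    (ht : ∀ x : ℝ, ∃! k : ℤ, x + k ∈ W)
    (hd : ∀ x : ℝ, x ≠ 0 → ∃! j : ℤ, (2 : ℝ) ^ j * x ∈ W) :
    ∃ ψ : Lp ℂ 2 (volume : Measure ℝ), IsWavelet ψ ∧
      ((𝓕 ψ : Lp ℂ 2 (volume : Measure ℝ)) : ℝ → ℂ) =ᵐ[volume] W.indicator 1 := by
  have hv : volume W ≠ ∞ := by rw [volume_of_tile hW ht]; exact ENNReal.one_ne_top
  set v := tileAtomLp hW hv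
  have hinv : ∀ p, ((𝓕⁻ (v p) : Lp ℂ 2 (volume : Measure ℝ)) : ℝ → ℂ) =ᵐ[volume]
      𝓕⁻ (tileAtom W p.1 p.2) := fun p => by
    have hae := (memLp_tileAtom hW hv p.1 p.2 2).coeFn_toLp
    have hint := memLp_one_iff_integrable.1 (memLp_tileAtom hW hv p.1 p.2 1)
    refine (Lp.fourierInv_ae_eq_of_integrable _ (hint.congr hae.symm)).trans (.of_forall ?_)
    exact fun x => Real.fourierInv_congr_ae hae x
  have horth := orthonormal_tileAtomLp hW hv ht hd
  have hbot : (Submodule.span ℂ (Set.range v))ᗮ = ⊥ := by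
    rw [Submodule.eq_bot_iff]
    intro f hf
    refine eq_zero_of_inner_tileAtomLp_eq_zero hW hv ht hd f fun p => ?_
    exact hf _ (Submodule.subset_span ⟨p, rfl⟩)
  set b := HilbertBasis.mkOfOrthogonalEqBot horth hbot with hb
  have hbv : ∀ p, b p = v p := fun p => by
    rw [hb, HilbertBasis.coe_mkOfOrthogonalEqBot]
  -- The Fourier transform is unitary, so the atom basis pulls back to a Hilbert basis with members
  -- 𝓕⁻ (v p).
  refine ⟨𝓕⁻ (v (0, 0)), ⟨HilbertBasis.ofRepr
    ((Lp.fourierTransformₗᵢ ℝ ℂ).trans b.repr), fun j k => ?_⟩, ?_⟩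
  · have h1 : HilbertBasis.ofRepr ((Lp.fourierTransformₗᵢ ℝ ℂ).trans b.repr) (j, k) =
        𝓕⁻ (v (j, k)) := by
      rw [← hbv]; rfl
    rw [h1]
    filter_upwards [hinv (j, k), (quasiMeasurePreserving_const_mul_sub
      (by positivity : (2 : ℝ) ^ j ≠ 0) (k : ℝ)).ae (hinv (0, 0))] with x hx hx'
    rw [hx, waveletSystem, hx', fourierInv_tileAtom]
  · rw [FourierTransform.fourier_fourierInv_eq]
    refine (memLp_tileAtom hW hv 0 0 2).coeFn_toLp.trans (.of_forall fun x => ?_)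
    by_cases h : x ∈ W <;> simp [tileAtom, h]

end

/-! ### Transferring tilings, and the Shannon set -/

/-- Since `f` moves points only within their orbits, any point of W in the orbit of x is the image
of a point of S in that orbit, and there is only one. The dilation version below has the same
reason. -/
theorem existsUnique_add_int_mem_of_surjOn {S W : Set ℝ} (f : ℝ → ℝ)
    (hf : ∀ s ∈ S, f s ∈ W ∧ ∃ k : ℤ, f s = s + k) (hsurj : Set.SurjOn f S W)
    (hS : ∀ x : ℝ, ∃! k : ℤ, x + k ∈ S) (x : ℝ) : ∃! k : ℤ, x + k ∈ W := by
  obtain ⟨k, hk, -⟩ := hS x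
  obtain ⟨hw, l, hl⟩ := hf _ hk
  refine ⟨k + l, by push_cast; rwa [← add_assoc, ← hl], ?_⟩
  have key : ∀ y : ℤ, x + y ∈ W → f (x + k) = x + y := by
    intro y hy
    obtain ⟨s, hs, hsy⟩ := hsurj hy
    obtain ⟨-, m, hm⟩ := hf s hs
    have h1 : s = x + (y - m : ℤ) := by push_cast; linarith
    have h2 := (hS x).unique (h1 ▸ hs) hk
    rw [← h2, ← h1, hsy]
  intro y hy
  have h1 := key y hy
  rw [hl] at h1
  have : (y : ℝ) = (k + l : ℤ) := by push_cast; linarith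
  exact_mod_cast this

theorem existsUnique_two_zpow_mul_mem_of_surjOn {S W : Set ℝ} (f : ℝ → ℝ)
    (hf : ∀ s ∈ S, f s ∈ W ∧ ∃ j : ℤ, f s = (2 : ℝ) ^ j * s) (hsurj : Set.SurjOn f S W)
    (hS : ∀ x : ℝ, x ≠ 0 → ∃! j : ℤ, (2 : ℝ) ^ j * x ∈ S) (x : ℝ) (hx : x ≠ 0) :
    ∃! j : ℤ, (2 : ℝ) ^ j * x ∈ W := by
  obtain ⟨k, hk, -⟩ := hS x hx
  obtain ⟨hw, l, hl⟩ := hf _ hk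
  have hl' : f ((2 : ℝ) ^ k * x) = (2 : ℝ) ^ (l + k) * x := by
    rw [hl, ← mul_assoc, ← zpow_add₀ two_ne_zero]
  refine ⟨l + k, by rwa [hl'] at hw, ?_⟩
  have key : ∀ y : ℤ, (2 : ℝ) ^ y * x ∈ W → f ((2 : ℝ) ^ k * x) = (2 : ℝ) ^ y * x := by
    intro y hy
    obtain ⟨s, hs, hsy⟩ := hsurj hy
    obtain ⟨-, m, hm⟩ := hf s hs
    have h1 : s = (2 : ℝ) ^ (-m + y) * x := by
      rw [zpow_add₀ two_ne_zero, mul_assoc, ← hsy, hm, ← mul_assoc, ← zpow_add₀ two_ne_zero]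
      simp
    have h2 := (hS x hx).unique (h1 ▸ hs) hk
    rw [← h2, ← h1, hsy]
  intro y hy
  have h1 := key y hy
  rw [hl'] at h1
  exact (zpow_right_injective₀ two_pos (by norm_num) (mul_right_cancel₀ hx h1)).symm

/-- The Shannon wavelet set. -/
def shannonSet : Set ℝ := Set.Ico (-1) (-1 / 2) ∪ Set.Ico (1 / 2) 1

theorem existsUnique_add_int_mem_shannonSet (x : ℝ) : ∃! k : ℤ, x + k ∈ shannonSet := by
  have hS : ∀ y : ℝ, y ∈ shannonSet ↔ (-1 ≤ y ∧ y < -1 / 2) ∨ (1 / 2 ≤ y ∧ y < 1) := fun y => by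
    simp [shannonSet]
  have h0 := Int.floor_le x
  have h1 := Int.lt_floor_add_one x
  rcases lt_or_ge (x - ⌊x⌋) (1 / 2) with h | h
  · refine ⟨-⌊x⌋ - 1, (hS _).2 ?_, ?_⟩
    · push_cast; left; constructor <;> linarith
    · intro y hy
      rw [hS] at hy
      rcases hy with hy | hy
      · have h2 : y < -⌊x⌋ := by
          have : (y : ℝ) < (-⌊x⌋ : ℤ) := by push_cast; linarith
          exact_mod_cast this
        have h3 : -⌊x⌋ - 2 < y := by
          have : ((-⌊x⌋ - 2 : ℤ) : ℝ) < y := by push_cast; linarith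
          exact_mod_cast this
        omega
      · have h2 : y < -⌊x⌋ + 1 := by
          have : (y : ℝ) < (-⌊x⌋ + 1 : ℤ) := by push_cast; linarith
          exact_mod_cast this
        have h3 : -⌊x⌋ < y := by
          have : ((-⌊x⌋ : ℤ) : ℝ) < y := by push_cast; linarith
          exact_mod_cast this
        omega
  · refine ⟨-⌊x⌋, (hS _).2 ?_, ?_⟩
    · push_cast; right; constructor <;> linarith
    · intro y hy
      rw [hS] at hy
      rcases hy with hy | hy
      · have h2 : y < -⌊x⌋ - 1 := by
          have : (y : ℝ) < (-⌊x⌋ - 1 : ℤ) := by push_cast; linarith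
          exact_mod_cast this
        have h3 : -⌊x⌋ - 2 < y := by
          have : ((-⌊x⌋ - 2 : ℤ) : ℝ) < y := by push_cast; linarith
          exact_mod_cast this
        omega
      · have h2 : y < -⌊x⌋ + 1 := by
          have : (y : ℝ) < (-⌊x⌋ + 1 : ℤ) := by push_cast; linarith
          exact_mod_cast this
        have h3 : -⌊x⌋ - 1 < y := by
          have : ((-⌊x⌋ - 1 : ℤ) : ℝ) < y := by push_cast; linarith
          exact_mod_cast this
        omega

theorem existsUnique_two_zpow_mul_mem_shannonSet (x : ℝ) (hx : x ≠ 0) :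
    ∃! j : ℤ, (2 : ℝ) ^ j * x ∈ shannonSet := by
  have hp : ∀ j : ℤ, (0 : ℝ) < 2 ^ j := fun j => by positivity
  have huniq : ∀ i j : ℤ, (2 : ℝ) ^ i * x ∈ shannonSet → (2 : ℝ) ^ j * x ∈ shannonSet →
      ¬ i < j := by
    intro i j hi hj hij
    have h1 : (2 : ℝ) ^ (i + 1) ≤ 2 ^ j := zpow_le_zpow_right₀ (by norm_num) hij
    rw [zpow_add_one₀ two_ne_zero] at h1
    have hi0 := hp i
    have hj0 := hp j
    simp only [shannonSet, Set.mem_union, Set.mem_Ico] at hi hj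
    rcases lt_or_gt_of_ne hx with hx | hx <;> rcases hi with hi | hi <;> rcases hj with hj | hj <;>
      nlinarith
  have hex : ∃ j : ℤ, (2 : ℝ) ^ j * x ∈ shannonSet := by
    rcases lt_or_gt_of_ne hx with hx | hx
    -- The negative half of the Shannon set contains -1 but not -1/2, so `-x` needs an interval
    -- closed on the right; the positive half needs one closed on the left.
    · obtain ⟨m, hm1, hm2⟩ := exists_mem_Ioc_zpow (neg_pos.2 hx) (one_lt_two (α := ℝ))
      refine ⟨-(m + 1), Or.inl ?_⟩
      have h0 := hp m
      rw [zpow_neg, Set.mem_Ico, zpow_add_one₀ two_ne_zero] at *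
      rw [inv_mul_eq_div, le_div_iff₀ (by positivity), div_lt_iff₀ (by positivity)]
      constructor <;> linarith
    · obtain ⟨m, hm1, hm2⟩ := exists_mem_Ico_zpow hx (one_lt_two (α := ℝ))
      refine ⟨-(m + 1), Or.inr ?_⟩
      have h0 := hp m
      rw [zpow_neg, Set.mem_Ico, zpow_add_one₀ two_ne_zero] at *
      rw [inv_mul_eq_div, le_div_iff₀ (by positivity), div_lt_iff₀ (by positivity)]
      constructor <;> linarith
  obtain ⟨j, hj⟩ := hex
  refine ⟨j, hj, fun i hi => ?_⟩
  have := huniq i j hi hj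
  have := huniq j i hj hi
  omega

/-! ### Construction of the far wavelet set -/

/-- The parts `±2/3 + [0, c)` of the Shannon set that are moved by integer translations. -/
def innerPart (c : ℝ) : Set ℝ := Set.Ico (-2 / 3) (-2 / 3 + c) ∪ Set.Ico (2 / 3) (2 / 3 + c)

/-- The sets `±2^{n+1}/3 + [0, c)`. -/
def outerPart (n : ℕ) (c : ℝ) : Set ℝ :=
  Set.Ico (-(2 ^ n * (2 / 3))) (-(2 ^ n * (2 / 3)) + c) ∪
    Set.Ico (2 ^ n * (2 / 3)) (2 ^ n * (2 / 3) + c)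

/-- The integer translate in the Shannon set of a quarter of a point of the Shannon set. -/
noncomputable def quarterShift (x : ℝ) : ℝ := if 0 < x then x / 4 - 1 else x / 4 + 1

/-- The points of `innerPart c` missed by the dilates of `outerPart n c`, and their iterated
images under `quarterShift`. -/
def missedLevel (n : ℕ) (c : ℝ) : ℕ → Set ℝ
  | 0 => innerPart c \ innerPart (c / 2 ^ n)
  | k + 1 => quarterShift '' missedLevel n c k

/-- The part of the Shannon set whose points are divided by four. -/
def missedSet (n : ℕ) (c : ℝ) : Set ℝ := ⋃ k, missedLevel n c k

/-- A wavelet set containing `outerPart n c`. -/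
def farWaveletSet (n : ℕ) (c : ℝ) : Set ℝ :=
  (shannonSet \ (innerPart c ∪ quarterShift '' missedSet n c)) ∪
    (outerPart n c ∪ {x | 4 * x ∈ missedSet n c})

section

variable {n : ℕ} {c : ℝ}

/-- This equation reconciles the two tilings: as I(c/2^n) ⊆ I(c), it gives I(c) ∪ QM = I(c/2^n) ∪ M,
so the same part of S is left fixed by the translation and the dilation rearrangements. -/
theorem mem_missedSet {x : ℝ} : x ∈ missedSet n c ↔
    x ∈ innerPart c \ innerPart (c / 2 ^ n) ∨ x ∈ quarterShift '' missedSet n c := by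
  rw [missedSet, Set.image_iUnion, Set.mem_iUnion, Set.mem_iUnion]
  constructor
  · rintro ⟨_ | k, hk⟩
    · exact Or.inl hk
    · exact Or.inr ⟨k, hk⟩
  · rintro (h | ⟨k, hk⟩)
    · exact ⟨0, h⟩
    · exact ⟨k + 1, hk⟩

/-- The image stays clear of ±2/3 + [0, 1/12), which is where the bound c ≤ 1/12 comes from. Halving
in place of quartering would fail: 2/3 ↦ 1/3 - 1 = -2/3 falls back into the inner part. -/
theorem quarterShift_mem {x : ℝ} (hx : x ∈ shannonSet) :
    quarterShift x ∈ Set.Ico (-7 / 8) (-3 / 4) ∪ Set.Ico (3 / 4) (7 / 8) := by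
  simp only [shannonSet, Set.mem_union, Set.mem_Ico] at hx ⊢
  unfold quarterShift
  split_ifs with h
  · left; rcases hx with hx | hx <;> constructor <;> linarith
  · right; rcases hx with hx | hx <;> constructor <;> linarith

theorem quarterShift_mem_shannonSet {x : ℝ} (hx : x ∈ shannonSet) :
    quarterShift x ∈ shannonSet := by
  have := quarterShift_mem hx
  simp only [shannonSet, Set.mem_union, Set.mem_Ico] at this ⊢
  rcases this with h | h
  · left; constructor <;> linarith
  · right; constructor <;> linarith

theorem quarterShift_notMem_innerPart (hc : c ≤ 1 / 12) {x : ℝ} (hx : x ∈ shannonSet) :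
    quarterShift x ∉ innerPart c := by
  have := quarterShift_mem hx
  simp only [innerPart, Set.mem_union, Set.mem_Ico, not_or, not_and, not_lt] at this ⊢
  constructor <;> intro <;> rcases this with h | h <;> linarith

theorem injOn_quarterShift : Set.InjOn quarterShift shannonSet := by
  intro x hx y hy h
  simp only [shannonSet, Set.mem_union, Set.mem_Ico] at hx hy
  unfold quarterShift at h
  split_ifs at h <;> rcases hx with hx | hx <;> rcases hy with hy | hy <;> linarith

theorem measurable_quarterShift : Measurable quarterShift :=
  Measurable.ite measurableSet_Ioi (by fun_prop) (by fun_prop)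

theorem innerPart_subset_shannonSet (hc : c ≤ 1 / 12) : innerPart c ⊆ shannonSet := by
  intro x hx
  simp only [shannonSet, innerPart, Set.mem_union, Set.mem_Ico] at hx ⊢
  rcases hx with h | h
  · left; constructor <;> linarith
  · right; constructor <;> linarith

theorem measurableSet_innerPart (c : ℝ) : MeasurableSet (innerPart c) :=
  measurableSet_Ico.union measurableSet_Ico

/-- Injective measurable images of Borel sets are Borel; `quarterShift` is injective on S, so
containment in S is carried through the induction. -/
theorem measurableSet_missedLevel (hc : c ≤ 1 / 12) (k : ℕ) :
    missedLevel n c k ⊆ shannonSet ∧ MeasurableSet (missedLevel n c k) := by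
  induction k with
  | zero => exact ⟨Set.sdiff_subset.trans (innerPart_subset_shannonSet hc),
      (measurableSet_innerPart _).diff (measurableSet_innerPart _)⟩
  | succ k ih =>
    refine ⟨?_, ih.2.image_of_measurable_injOn measurable_quarterShift
      (injOn_quarterShift.mono ih.1)⟩
    rintro _ ⟨x, hx, rfl⟩
    exact quarterShift_mem_shannonSet (ih.1 hx)

theorem missedSet_subset_shannonSet (hc : c ≤ 1 / 12) : missedSet n c ⊆ shannonSet :=
  Set.iUnion_subset fun k => (measurableSet_missedLevel hc k).1

theorem measurableSet_missedSet (hc : c ≤ 1 / 12) : MeasurableSet (missedSet n c) :=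
  MeasurableSet.iUnion fun k => (measurableSet_missedLevel hc k).2

theorem measurableSet_farWaveletSet (hc : c ≤ 1 / 12) : MeasurableSet (farWaveletSet n c) := by
  have h1 : MeasurableSet shannonSet := measurableSet_Ico.union measurableSet_Ico
  have h2 : MeasurableSet (quarterShift '' missedSet n c) :=
    (measurableSet_missedSet hc).image_of_measurable_injOn measurable_quarterShift
      (injOn_quarterShift.mono (missedSet_subset_shannonSet hc))
  exact (h1.diff ((measurableSet_innerPart c).union h2)).union
    ((measurableSet_Ico.union measurableSet_Ico).union
      ((measurable_const_mul 4) (measurableSet_missedSet hc)))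

theorem exists_neg_two_pow_eq (n : ℕ) : ∃ q : ℤ, (-2 : ℝ) ^ n = 3 * q + 1 := by
  induction n with
  | zero => exact ⟨0, by simp⟩
  | succ n ih =>
    obtain ⟨q, hq⟩ := ih
    exact ⟨-2 * q - 1, by rw [pow_succ, hq]; push_cast; ring⟩

/-- Replacing a by -a exchanges the intervals a + [0, c) and -a + [0, c), so the parity of n is
irrelevant. -/
theorem mem_outerPart_iff {x : ℝ} : x ∈ outerPart n c ↔
    ((-2) ^ n * (2 / 3) ≤ x ∧ x < (-2) ^ n * (2 / 3) + c) ∨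
      (-((-2) ^ n * (2 / 3)) ≤ x ∧ x < -((-2) ^ n * (2 / 3)) + c) := by
  simp only [outerPart, Set.mem_union, Set.mem_Ico]
  rcases Nat.even_or_odd n with h | h
  · rw [h.neg_pow]; exact or_comm
  · rw [h.neg_pow]; simp only [neg_mul, neg_neg]

-- The rearrangement of S onto W shifts I(c) by ±2q, where (-2)^n = 3q + 1 gives 2/3 + 2q = (-2)^n ·
-- 2/3, sends Qg to g/4 for g in M, and fixes the rest.
open Classical in
theorem existsUnique_add_int_mem_farWaveletSet (hc0 : 0 < c) (hc : c ≤ 1 / 12) (x : ℝ) :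
    ∃! k : ℤ, x + k ∈ farWaveletSet n c := by
  obtain ⟨q, hq⟩ := exists_neg_two_pow_eq n
  set f : ℝ → ℝ := fun s =>
    if s ∈ innerPart c then (if 0 < s then s + (2 * q : ℤ) else s + (-2 * q : ℤ))
    else if s ∈ quarterShift '' missedSet n c then
      (if 0 < s then s + (-1 : ℤ) else s + (1 : ℤ)) else s with hf
  have hfq : ∀ g ∈ missedSet n c, f (quarterShift g) = g / 4 := by
    intro g hg
    have hgS := missedSet_subset_shannonSet hc hg
    rw [hf]
    simp only [quarterShift_notMem_innerPart hc hgS, Set.mem_image_of_mem _ hg, if_true, if_false]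
    have h1 := quarterShift_mem hgS
    simp only [shannonSet, Set.mem_union, Set.mem_Ico] at h1 hgS
    unfold quarterShift at *
    split_ifs at * <;> push_cast <;> rcases h1 with h1 | h1 <;> rcases hgS with hgS | hgS <;> linarith
  have hfi : ∀ s ∈ innerPart c, f s = if 0 < s then s + 2 * q else s - 2 * q := by
    intro s hs
    simp only [hf, hs, if_true]
    push_cast
    simp only [neg_mul, sub_eq_add_neg]
  have hfo : ∀ s, s ∉ innerPart c → s ∉ quarterShift '' missedSet n c → f s = s := by
    intro s h1 h2
    simp only [hf, h1, h2, if_false]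
  refine existsUnique_add_int_mem_of_surjOn f ?_ ?_ existsUnique_add_int_mem_shannonSet x
  · intro s hs
    refine ⟨?_, ?_⟩
    · by_cases h1 : s ∈ innerPart c
      · refine Or.inr (Or.inl ?_)
        rw [mem_outerPart_iff, hfi s h1, hq]
        simp only [innerPart, Set.mem_union, Set.mem_Ico] at h1
        split_ifs with h0
        · left; rcases h1 with h1 | h1 <;> constructor <;> linarith
        · right; rcases h1 with h1 | h1 <;> constructor <;> linarith
      · by_cases h2 : s ∈ quarterShift '' missedSet n c
        · obtain ⟨g, hg, rfl⟩ := h2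
          refine Or.inr (Or.inr ?_)
          rw [hfq g hg]
          simpa [mul_div_cancel₀] using hg
        · rw [hfo s h1 h2]
          exact Or.inl ⟨hs, fun h => h.elim h1 h2⟩
    · simp only [hf]
      split_ifs
      · exact ⟨_, rfl⟩
      · exact ⟨_, rfl⟩
      · exact ⟨_, rfl⟩
      · exact ⟨_, rfl⟩
      · exact ⟨0, by simp⟩
  · rintro w (⟨hw, hw'⟩ | hw | hw)
    · rw [Set.mem_union, not_or] at hw'
      exact ⟨w, hw, hfo w hw'.1 hw'.2⟩
    · rw [mem_outerPart_iff, hq] at hw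
      rcases hw with hw | hw
      · have h1 : w - 2 * q ∈ innerPart c := by
          right; constructor <;> linarith
        refine ⟨_, innerPart_subset_shannonSet hc h1, ?_⟩
        rw [hfi _ h1, if_pos (by linarith)]; ring
      · have h1 : w + 2 * q ∈ innerPart c := by
          left; constructor <;> linarith
        refine ⟨_, innerPart_subset_shannonSet hc h1, ?_⟩
        rw [hfi _ h1, if_neg (by linarith)]; ring
    · refine ⟨quarterShift (4 * w), quarterShift_mem_shannonSet
        (missedSet_subset_shannonSet hc hw), ?_⟩
      rw [hfq _ hw]; ring

-- The rearrangement multiplies I(c/2^n) by 2^n, divides M by 4, and fixes the rest. It is well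
-- matched to W because M is disjoint from I(c/2^n) (`hnot`).
open Classical in
theorem existsUnique_two_zpow_mul_mem_farWaveletSet (hc0 : 0 < c) (hc : c ≤ 1 / 12) (x : ℝ)
    (hx : x ≠ 0) : ∃! j : ℤ, (2 : ℝ) ^ j * x ∈ farWaveletSet n c := by
  have hpow : (1 : ℝ) ≤ 2 ^ n := one_le_pow₀ (by norm_num)
  have hpos : (0 : ℝ) < 2 ^ n := by positivity
  have hcn : c / 2 ^ n ≤ c := div_le_self hc0.le hpow
  have hsub : innerPart (c / 2 ^ n) ⊆ innerPart c := by
    rintro y (hy | hy)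
    · exact Or.inl ⟨hy.1, by linarith [hy.2]⟩
    · exact Or.inr ⟨hy.1, by linarith [hy.2]⟩
  have hnot : ∀ g ∈ missedSet n c, g ∉ innerPart (c / 2 ^ n) := by
    intro g hg
    rcases mem_missedSet.1 hg with h | ⟨y, hy, rfl⟩
    · exact h.2
    · exact fun h => quarterShift_notMem_innerPart hc (missedSet_subset_shannonSet hc hy) (hsub h)
  have hscale : ∀ w, w ∈ outerPart n c ↔ w / 2 ^ n ∈ innerPart (c / 2 ^ n) := by
    intro w
    simp only [outerPart, innerPart, Set.mem_union, Set.mem_Ico]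
    rw [le_div_iff₀ hpos, le_div_iff₀ hpos, div_lt_iff₀ hpos, div_lt_iff₀ hpos, add_mul, add_mul,
      div_mul_cancel₀ c hpos.ne']
    ring_nf
  set f : ℝ → ℝ := fun s =>
    if s ∈ innerPart (c / 2 ^ n) then (2 : ℝ) ^ (n : ℤ) * s
    else if s ∈ missedSet n c then (2 : ℝ) ^ (-2 : ℤ) * s else s with hf
  refine existsUnique_two_zpow_mul_mem_of_surjOn f ?_ ?_
    existsUnique_two_zpow_mul_mem_shannonSet x hx
  · intro s hs
    refine ⟨?_, ?_⟩
    · by_cases h1 : s ∈ innerPart (c / 2 ^ n)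
      · refine Or.inr (Or.inl ?_)
        simp only [hf, h1, if_true]
        rw [hscale, zpow_natCast, mul_div_cancel_left₀ _ hpos.ne']
        exact h1
      · by_cases h2 : s ∈ missedSet n c
        · refine Or.inr (Or.inr ?_)
          simp only [hf, h1, h2, if_true, if_false, Set.mem_ofPred_eq]
          convert h2 using 1
          norm_num [← mul_assoc]
        · refine Or.inl ?_
          simp only [hf, h1, h2, if_false]
          refine ⟨hs, ?_⟩
          rintro (h3 | h3)
          · exact h2 (mem_missedSet.2 (Or.inl ⟨h3, h1⟩))
          · exact h2 (mem_missedSet.2 (Or.inr h3))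
    · simp only [hf]
      split_ifs
      · exact ⟨_, rfl⟩
      · exact ⟨_, rfl⟩
      · exact ⟨0, by simp⟩
  · rintro w (⟨hw, hw'⟩ | hw | hw)
    · rw [Set.mem_union, not_or] at hw'
      have h1 : w ∉ innerPart (c / 2 ^ n) := fun h => hw'.1 (hsub h)
      have h2 : w ∉ missedSet n c := fun h => by
        rcases mem_missedSet.1 h with h | h
        · exact hw'.1 h.1
        · exact hw'.2 h
      exact ⟨w, hw, by simp [hf, h1, h2]⟩
    · have h1 := (hscale w).1 hw
      refine ⟨_, innerPart_subset_shannonSet hc (hsub h1), ?_⟩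
      simp only [hf, h1, if_true, zpow_natCast]
      field_simp
    · have h1 : 4 * w ∈ missedSet n c := hw
      refine ⟨4 * w, missedSet_subset_shannonSet hc h1, ?_⟩
      simp only [hf, hnot _ h1, h1, if_true, if_false]
      norm_num [← mul_assoc]

theorem farWaveletSet_subset (hn : 1 ≤ n) (hc0 : 0 < c) (hc : c ≤ 1 / 12) :
    farWaveletSet n c ⊆ Set.Icc (-(2 ^ n * (2 / 3))) (2 ^ n * (2 / 3) + c) := by
  have hpow : (2 : ℝ) ≤ 2 ^ n := le_self_pow₀ (by norm_num) (by omega)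
  rintro w (⟨hw, -⟩ | hw | hw)
  · simp only [shannonSet, Set.mem_union, Set.mem_Ico] at hw
    rcases hw with hw | hw <;> constructor <;> linarith
  · simp only [outerPart, Set.mem_union, Set.mem_Ico] at hw
    rcases hw with hw | hw <;> constructor <;> linarith
  · have hw := missedSet_subset_shannonSet hc hw
    simp only [shannonSet, Set.mem_union, Set.mem_Ico] at hw
    rcases hw with hw | hw <;> constructor <;> linarith

end

/-! ### Support and dimension function -/

theorem essentialSupport_subset_of_ae_eq_indicator {f : ℝ → ℂ} {S C : Set ℝ} (hC : IsClosed C)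
    (hSC : S ⊆ C) (hf : f =ᵐ[volume] S.indicator 1) : essentialSupport f ⊆ C := by
  intro x hx
  by_contra hxC
  refine (hx Cᶜ (hC.isOpen_compl.mem_nhds hxC)).ne' (measure_mono_null ?_ hf)
  rintro y ⟨hyC, hy⟩
  simp only [Set.mem_compl_iff, Set.mem_ofPred_eq]
  rwa [Set.indicator_of_notMem fun h => hyC (hSC h)]

theorem angularFourier_ae_eq_indicator {ψ : Lp ℂ 2 (volume : Measure ℝ)} {W : Set ℝ}
    (h : ((𝓕 ψ : Lp ℂ 2 (volume : Measure ℝ)) : ℝ → ℂ) =ᵐ[volume] W.indicator 1) :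
    angularFourier ψ =ᵐ[volume] {ξ | ξ / (2 * Real.pi) ∈ W}.indicator 1 := by
  have hpi : (2 * Real.pi)⁻¹ ≠ 0 := by positivity
  filter_upwards [(quasiMeasurePreserving_const_mul hpi).ae h] with ξ hξ
  rw [inv_mul_eq_div] at hξ
  rw [angularFourier, hξ]
  rfl

/-- Each term composes the transform with an affine map of nonzero slope, which pulls null sets back
to null sets, and there are countably many terms. -/
theorem dimensionFunction_ae_eq {ψ : Lp ℂ 2 (volume : Measure ℝ)} {W : Set ℝ}
    (h : ((𝓕 ψ : Lp ℂ 2 (volume : Measure ℝ)) : ℝ → ℂ) =ᵐ[volume] W.indicator 1) :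
    ∀ᵐ ξ : ℝ, dimensionFunction ψ ξ = ∑' (i : ℕ) (k : ℤ),
      W.indicator (1 : ℝ → ℝ≥0∞) ((2 : ℝ) ^ (i + 1) * (ξ / (2 * Real.pi) + k)) := by
  have hpi := Real.pi_pos
  have h1 : ∀ (i : ℕ) (k : ℤ), ∀ᵐ ξ : ℝ,
      angularFourier ψ ((2 : ℝ) ^ (i + 1) * (ξ + 2 * (k : ℝ) * Real.pi)) =
        W.indicator 1 ((2 : ℝ) ^ (i + 1) * (ξ / (2 * Real.pi) + k)) := by
    intro i k
    have hq := quasiMeasurePreserving_const_mul_sub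
      (by positivity : (2 : ℝ) ^ (i + 1) / (2 * Real.pi) ≠ 0) (-((2 : ℝ) ^ (i + 1) * k))
    filter_upwards [hq.ae h] with ξ hξ
    have e1 : (2 : ℝ) ^ (i + 1) / (2 * Real.pi) * ξ - -((2 : ℝ) ^ (i + 1) * k) =
        (2 : ℝ) ^ (i + 1) * (ξ / (2 * Real.pi) + k) := by ring
    have e2 : (2 : ℝ) ^ (i + 1) * (ξ + 2 * (k : ℝ) * Real.pi) / (2 * Real.pi) =
        (2 : ℝ) ^ (i + 1) * (ξ / (2 * Real.pi) + k) := by field_simp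
    rw [e1] at hξ
    rw [angularFourier, e2, hξ]
  filter_upwards [ae_all_iff.2 fun i => ae_all_iff.2 (h1 i)] with ξ hξ
  unfold dimensionFunction
  congr 1; ext i; congr 1; ext k
  rw [hξ i k]
  by_cases hm : (2 : ℝ) ^ (i + 1) * (ξ / (2 * Real.pi) + k) ∈ W <;> simp [hm]

/-- With (-2)^(n-i) = 3q + 1 one has 1/3 + q = (-2)^(n-i)/3, so the factor 2^(i+1) sends 1/3 + q to
±2^(n+1)/3. The excess 2^(i+1)(x - 1/3) stays below c since i ≤ n. -/
theorem exists_two_pow_mul_mem_farWaveletSet {n : ℕ} {c x : ℝ} (hx0 : 1 / 3 < x)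
    (hx : x < 1 / 3 + c / 2 ^ (n + 1)) {i : ℕ} (hi : i ≤ n) :
    ∃ k : ℤ, (2 : ℝ) ^ (i + 1) * (x + k) ∈ farWaveletSet n c := by
  obtain ⟨q, hq⟩ := exists_neg_two_pow_eq (n - i)
  refine ⟨q, Or.inr (Or.inl ?_)⟩
  have hpow : (2 : ℝ) ^ (i + 1) ≤ 2 ^ (n + 1) := pow_le_pow_right₀ (by norm_num) (by omega)
  have hi0 : (0 : ℝ) < 2 ^ (i + 1) := by positivity
  have h1 : 0 < (2 : ℝ) ^ (i + 1) * (x - 1 / 3) := mul_pos hi0 (by linarith)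
  have h2 : (2 : ℝ) ^ (i + 1) * (x - 1 / 3) < c := by
    have h3 : (2 : ℝ) ^ (i + 1) * (x - 1 / 3) ≤ 2 ^ (n + 1) * (x - 1 / 3) :=
      mul_le_mul_of_nonneg_right hpow (by linarith)
    have h4 : (x - 1 / 3) < c / 2 ^ (n + 1) := by linarith
    rw [lt_div_iff₀ (by positivity)] at h4
    linarith
  have h3 : (2 : ℝ) ^ (i + 1) * (x + q) =
      2 ^ (i + 1) * (-2) ^ (n - i) / 3 + 2 ^ (i + 1) * (x - 1 / 3) := by
    rw [hq]; ring
  have h4 : (2 : ℝ) ^ (i + 1) * 2 ^ (n - i) = 2 ^ n * 2 := by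
    rw [← pow_add, ← pow_succ]; congr 1; omega
  rw [h3]
  rcases Nat.even_or_odd (n - i) with he | ho
  · rw [he.neg_pow, h4]
    right; constructor <;> linarith
  · rw [ho.neg_pow, mul_neg, h4]
    left; constructor <;> linarith

theorem succ_le_tsum_indicator_farWaveletSet {n : ℕ} {c x : ℝ} (hx0 : 1 / 3 < x)
    (hx : x < 1 / 3 + c / 2 ^ (n + 1)) :
    ((n + 1 : ℕ) : ℝ≥0∞) ≤ ∑' (i : ℕ) (k : ℤ),
      (farWaveletSet n c).indicator (1 : ℝ → ℝ≥0∞) ((2 : ℝ) ^ (i + 1) * (x + k)) := by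
  refine le_trans ?_ (ENNReal.sum_le_tsum (Finset.range (n + 1)))
  calc ((n + 1 : ℕ) : ℝ≥0∞) = ∑ i ∈ Finset.range (n + 1), 1 := by simp
    _ ≤ _ := Finset.sum_le_sum fun i hi => by
      obtain ⟨k, hk⟩ := exists_two_pow_mul_mem_farWaveletSet hx0 hx
        (Nat.lt_succ_iff.1 (Finset.mem_range.1 hi))
      refine le_trans ?_ (ENNReal.le_tsum k)
      simp [hk]

theorem theorem2 (n : ℕ) (hn : 1 ≤ n) (ε : ℝ) (hε : 0 < ε)
    (hεδ : ε < (2 : ℝ) ^ (n + 2) * Real.pi / (3 * ((2 : ℝ) ^ (n + 2) - 1))) :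
    ∃ ψ : Lp ℂ 2 (volume : Measure ℝ),
      IsWavelet ψ ∧
      essentialSupport (angularFourier ψ) ⊆
        Set.Icc (-((2 : ℝ) ^ (n + 2) * Real.pi / 3)) ((2 : ℝ) ^ (n + 2) * Real.pi / 3 + ε) ∧
      (n : ℝ≥0∞) < eLpNorm (dimensionFunction ψ) ∞ volume := by
  have hpi := Real.pi_pos
  -- In angular frequency the far set overshoots 2^(n+2)π/3 by 2πc, which must be at most ε.
  obtain ⟨c, hc0, hc, hcε⟩ : ∃ c : ℝ, 0 < c ∧ c ≤ 1 / 12 ∧ c * (2 * Real.pi) ≤ ε := by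
    refine ⟨min (1 / 12) (ε / (2 * Real.pi)), by positivity, min_le_left _ _, ?_⟩
    rw [← le_div_iff₀ (by positivity)]
    exact min_le_right _ _
  obtain ⟨ψ, hψ, hF⟩ := exists_isWavelet_of_tile (W := farWaveletSet n c)
    (measurableSet_farWaveletSet hc) (existsUnique_add_int_mem_farWaveletSet hc0 hc)
    (existsUnique_two_zpow_mul_mem_farWaveletSet hc0 hc)
  refine ⟨ψ, hψ, ?_, ?_⟩
  · refine essentialSupport_subset_of_ae_eq_indicator isClosed_Icc ?_
      (angularFourier_ae_eq_indicator hF)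
    intro ξ hξ
    have h := farWaveletSet_subset hn hc0 hc hξ
    rw [Set.mem_Icc, le_div_iff₀ (by positivity), div_le_iff₀ (by positivity)] at h
    rw [Set.mem_Icc, pow_add]
    constructor <;> linarith [h.1, h.2]
  · by_contra hlt
    rw [not_lt, eLpNorm_exponent_top] at hlt
    set r := c / 2 ^ (n + 1) with hr
    have hr0 : 0 < r := by positivity
    -- This is (1/3, 1/3 + r) in angular frequency. An essential supremum at most n would make it
    -- null, against its positive length.
    have hae : ∀ᵐ ξ : ℝ, ξ ∉ Set.Ioo (2 * Real.pi / 3) (2 * Real.pi / 3 + 2 * Real.pi * r) := by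
      filter_upwards [dimensionFunction_ae_eq hF,
        enorm_ae_le_eLpNormEssSup (dimensionFunction ψ) volume] with ξ hD hle hξ
      have h1 : 1 / 3 < ξ / (2 * Real.pi) := by
        rw [lt_div_iff₀ (by positivity)]; linarith [hξ.1]
      have h2 : ξ / (2 * Real.pi) < 1 / 3 + c / 2 ^ (n + 1) := by
        rw [div_lt_iff₀ (by positivity), ← hr]; linarith [hξ.2]
      have h3 := succ_le_tsum_indicator_farWaveletSet h1 h2
      rw [← hD] at h3
      have h4 : ((n + 1 : ℕ) : ℝ≥0∞) ≤ n := h3.trans (le_trans (by simp) (hle.trans hlt))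
      exact absurd (Nat.cast_le.1 h4) (by omega)
    have h0 := ae_iff.1 hae
    simp only [not_not, Set.ofPred_mem_eq, Real.volume_Ioo, ENNReal.ofReal_eq_zero] at h0
    have : 0 < 2 * Real.pi * r := by positivity
    linarith
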